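/- Let $R=\mathbb{C}[b_{i,j} : i\in\{1,2,3\},\ j\in\{1,3,5,\dots\}]$ be the ring of polynomial functions on the space $\mathbb{C}^{3\infty}$ with coordinates $b_{i,j}$, and set $\mathbf{b}_i(\xi)=\sum_{j\ge1}b_{i,2j-1}\xi^j$ for $i=1,2,3$. Define $\lambda_4,\lambda_6,\dots\in R$ by $$4\Big(\xi^{-1}+\sum_{j\ge1}\lambda_{2j+2}\xi^j\Big)=\mathbf{b}_2(\xi)^2+2\,\mathbf{b}_3(\xi)(1-\mathbf{b}_1(\xi))+4(\xi^{-1}+2b_{1,1})(1-\mathbf{b}_1(\xi))^2,$$ and define $a_4,a_6,\dots\in R$ recursively by $2a_{2k+2}=\lambda_{2k+2}-\sum_{i=1}^{k-2}a_{2i+2}\,a_{2k-2i}$ for $k\ge1$. Define $p_{s,k}\in R$, for odd $s,k\ge1$, as the coefficients in $$\sum_{i,j\ge1}p_{2i-1,2j-1}\xi^i\eta^j=\frac{\xi^2\eta^2}{(\xi-\eta)^2}\Big(2\xi^{-1}+2\eta^{-1}+4\sum_{i\ge1}\lambda_{4i+2}\xi^i\eta^i+2\sum_{i\ge0}\lambda_{4i+4}(\xi+\eta)\xi^i\eta^i-\mathbf{q}(\xi,\eta)\Big),$$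 where $$\mathbf{q}(\xi,\eta)=\mathbf{b}_2(\xi)\mathbf{b}_2(\eta)+(1-\mathbf{b}_1(\xi))\mathbf{b}_3(\eta)+\mathbf{b}_3(\xi)(1-\mathbf{b}_1(\eta))+2(1-\mathbf{b}_1(\xi))(1-\mathbf{b}_1(\eta))(\xi^{-1}+\eta^{-1}+4b_{1,1}).$$ (The bracketed series, multiplied by $\xi\eta$, is a formal power series divisible by $(\xi-\eta)^2$.) Define polynomial vector fields on $\mathbb{C}^{3\infty}$ by $$\mathcal{D}_1=\sum_{j\ \mathrm{odd}}\Big(b_{2,j}\frac{\partial}{\partial b_{1,j}}+b_{3,j}\frac{\partial}{\partial b_{2,j}}+4(2b_{1,1}b_{2,j}+b_{2,1}b_{1,j}+b_{2,j+2})\frac{\partial}{\partial b_{3,j}}\Big)$$ and, for odd $s\ge3$, $$\mathcal{D}_s=\frac12\sum_{j\ \mathrm{odd}}\Big(\mathcal{D}_1(p_{s,j})\frac{\partial}{\partial b_{1,j}}+\mathcal{D}_1^2(p_{s,j})\frac{\partial}{\partial b_{2,j}}+\mathcal{D}_1^3(p_{s,j})\frac{\partial}{\partial b_{3,j}}\Big).$$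 Identifying a polynomial with the operator of multiplication by it, consider the following operators on $R$: $\mathcal{L}=\mathcal{D}_1^2-2b_{1,1}$; for $k\ge1$, the polynomial Buchstaber--Shorina operators $$\mathcal{B}_{2k+1}=\mathcal{D}_{2k-1}\mathcal{D}_1^2-(b_{1,1}\mathcal{D}_{2k-1}+\mathcal{D}_{2k-1}b_{1,1})-\tfrac12(b_{1,2k-1}\mathcal{D}_1+\mathcal{D}_1b_{1,2k-1})-\mathcal{D}_{2k+1};$$ and, recursively for $k\ge0$, $$\mathcal{A}_{2k+1}=\sum_{j=1}^{k}\mathcal{B}_{2j+1}\mathcal{L}^{k-j}+\mathcal{D}_{2k+1}-\sum_{j=0}^{k-2}a_{2k-2j}\mathcal{A}_{2j+1}.$$ Then for every integer $k\ge0$ the following equality of operators holds, the left-hand side being the operator of multiplication by a polynomial: $$\mathcal{D}_{2k+1}(2b_{1,1})=\Big[\mathcal{L},\ \mathcal{A}_{2k+1}+\sum_{j=0}^{k-2}a_{2k-2j}\mathcal{A}_{2j+1}\Big].$$ (This system of equations for $k\ge1$ is called the polynomial parametric Korteweg--de Vries hierarchy.) -/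

import Mathlib

noncomputable section

namespace PolyKdV

/-- The polynomial functions on `ℂ^{3∞}`: polynomials over `ℂ` in the coordinates
`b_{i,2n+1}` with `i = 1, 2, 3` and `n = 0, 1, 2, …`.
The variable with index `(i, n)` is the coordinate `b_{i+1,2n+1}`. -/
abbrev Poly : Type := MvPolynomial (Fin 3 × ℕ) ℂ

/-- `b1 n` is the coordinate `b_{1,2n+1}`. -/
def b1 (n : ℕ) : Poly := MvPolynomial.X (0, n)

/-- `b2 n` is the coordinate `b_{2,2n+1}`. -/
def b2 (n : ℕ) : Poly := MvPolynomial.X (1, n)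

/-- `b3 n` is the coordinate `b_{3,2n+1}`. -/
def b3 (n : ℕ) : Poly := MvPolynomial.X (2, n)

/-! ### The coordinates `λ` and the parameters `a` as polynomials in `b` -/

/-- The generating series `𝐛(ξ) = ∑_{j ≥ 1} b_{2j-1} ξ^j` of a sequence `b_1, b_3, b_5, …`,
where `f n` is `b_{2n+1}`. -/
def genSeries (f : ℕ → Poly) : PowerSeries Poly := PowerSeries.X * PowerSeries.mk f

/-- `ξ` times the right-hand side of
`4 𝐦(ξ) = 𝐛₂(ξ)² + 2 𝐛₃(ξ)(1 - 𝐛₁(ξ)) + 4 (ξ⁻¹ + 2 b_{1,1})(1 - 𝐛₁(ξ))²`. -/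
def mxRhs : PowerSeries Poly :=
  PowerSeries.X * (genSeries b2 ^ 2 + 2 * genSeries b3 * (1 - genSeries b1))
    + 4 * (1 + 2 * PowerSeries.C (b1 0) * PowerSeries.X) * (1 - genSeries b1) ^ 2

/-- For `j ≥ 1`, `lam j` is `λ_{2j+2}`, the coefficient of `ξ^j` in
`𝐦(ξ) = ξ⁻¹ + ∑_{j ≥ 1} λ_{2j+2} ξ^j`. -/
def lam (j : ℕ) : Poly := MvPolynomial.C (1 / 4) * PowerSeries.coeff (j + 1) mxRhs

/-- The series `ξ 𝐦(ξ) = 1 + ∑_{j ≥ 1} λ_{2j+2} ξ^{j+1}`. -/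
def mxLhs : PowerSeries Poly :=
  1 + PowerSeries.X ^ 2 * PowerSeries.mk fun i => lam (i + 1)

/-- The parameters: for `n ≥ 2`, `par n` is `a_{2n}`, given by
`2 a_{2k+2} = λ_{2k+2} - ∑_{i=1}^{k-2} a_{2i+2} a_{2k-2i}` for `k ≥ 1`.
(In the code the summation index is `i - 1`; the values at `0` and `1` are never used.) -/
def par : ℕ → Poly
  | 0 => 0
  | k + 1 => MvPolynomial.C (1 / 2) *
      (lam k - ∑ i : Fin (k - 2), par (i.1 + 2) * par (k - (i.1 + 1)))
termination_by n => n
decreasing_by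
  · have := i.2; omega
  · omega

/-! ### The polynomials `p_{s,k}` -/

/-- Formal power series in `ξ` and `η`, as power series in `η` over power series in `ξ`. -/
abbrev Series2 : Type := PowerSeries (PowerSeries Poly)

/-- A series in one variable, written in the variable `ξ`. -/
def inXi (f : PowerSeries Poly) : Series2 := PowerSeries.C f

/-- A series in one variable, written in the variable `η`. -/
def inEta (f : PowerSeries Poly) : Series2 := PowerSeries.map PowerSeries.C f

/-- The variable `ξ`. -/
def xi : Series2 := inXi PowerSeries.X

/-- The variable `η`. -/
def eta : Series2 := PowerSeries.X

/-- A polynomial in `b`, as a constant series in `ξ` and `η`. -/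
def const2 (f : Poly) : Series2 := PowerSeries.C (PowerSeries.C f)

/-- The series `ξ η 𝐪(ξ, η)`, where
`𝐪(ξ, η) = 𝐛₂(ξ)𝐛₂(η) + (1 - 𝐛₁(ξ))𝐛₃(η) + 𝐛₃(ξ)(1 - 𝐛₁(η))
  + 2 (1 - 𝐛₁(ξ))(1 - 𝐛₁(η))(ξ⁻¹ + η⁻¹ + 4 b_{1,1})`. -/
def qSeries : Series2 :=
  xi * eta * (inXi (genSeries b2) * inEta (genSeries b2)
      + (1 - inXi (genSeries b1)) * inEta (genSeries b3)
      + inXi (genSeries b3) * (1 - inEta (genSeries b1)))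
    + 2 * (1 - inXi (genSeries b1)) * (1 - inEta (genSeries b1))
      * (eta + xi + 4 * const2 (b1 0) * (xi * eta))

/-- The series `∑_{i ≥ 1} λ_{4i+2} ξ^i η^i`. -/
def lamSeriesOdd : Series2 :=
  PowerSeries.mk fun i => PowerSeries.monomial i (if i = 0 then 0 else lam (2 * i))

/-- The series `∑_{i ≥ 0} λ_{4i+4} ξ^i η^i`. -/
def lamSeriesEven : Series2 :=
  PowerSeries.mk fun i => PowerSeries.monomial i (lam (2 * i + 1))

/-- The series `ξ η (2 ξ⁻¹ + 2 η⁻¹ + 4 ∑_{i ≥ 1} λ_{4i+2} ξ^i η^i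
  + 2 ∑_{i ≥ 0} λ_{4i+4} (ξ + η) ξ^i η^i - 𝐪(ξ, η))`. -/
def numSeries : Series2 :=
  2 * eta + 2 * xi + xi * eta * (4 * lamSeriesOdd + 2 * (xi + eta) * lamSeriesEven) - qSeries

/-- `numCoeff m n` is the coefficient of `ξ^m η^n` in `numSeries`. -/
def numCoeff (m n : ℕ) : Poly := PowerSeries.coeff m (PowerSeries.coeff n numSeries)

/-- `p m n` is `p_{2m+1,2n+1}`, the coefficient of `ξ^{m+1} η^{n+1}` in
`𝐩(ξ, η) = (ξ² η² / (ξ - η)²) (2 ξ⁻¹ + 2 η⁻¹ + … - 𝐪(ξ, η))`, that is, the coefficient of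
`ξ^m η^n` in the quotient of `numSeries` by `(ξ - η)²`. The formula comes from
`(ξ - η)⁻² = ∑_{k ≥ 0} (k + 1) η^k ξ^{-k-2}`; that the quotient is a power series in `ξ` and
`η` with these coefficients is `numSeries_eq`. -/
def p (m n : ℕ) : Poly :=
  ∑ k ∈ Finset.range (n + 1), ((k : Poly) + 1) * numCoeff (m + 2 + k) (n - k)

/-! ### Vector fields and operators -/

/-- The vector field `∑_n (c₁ n ∂/∂b_{1,2n+1} + c₂ n ∂/∂b_{2,2n+1} + c₃ n ∂/∂b_{3,2n+1})`. -/
def vectorField (c₁ c₂ c₃ : ℕ → Poly) : Derivation ℂ Poly Poly :=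
  MvPolynomial.mkDerivation ℂ fun x => ![c₁ x.2, c₂ x.2, c₃ x.2] x.1

/-- The vector field `𝒟_1`. -/
def D₁ : Derivation ℂ Poly Poly :=
  vectorField b2 b3 fun n => 4 * (2 * b1 0 * b2 n + b2 0 * b1 n + b2 (n + 1))

/-- `D n` is the vector field `𝒟_{2n+1}`. -/
def D : ℕ → Derivation ℂ Poly Poly
  | 0 => D₁
  | s + 1 => (1 / 2 : ℂ) • vectorField (fun n => D₁ (p (s + 1) n))
      (fun n => D₁ (D₁ (p (s + 1) n))) (fun n => D₁ (D₁ (D₁ (p (s + 1) n))))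

/-- Operators on polynomial functions; the product is composition. -/
abbrev Op : Type := Module.End ℂ Poly

/-- A vector field as an operator. -/
def opD (n : ℕ) : Op := (D n : Poly →ₗ[ℂ] Poly)

/-- The operator of multiplication by a polynomial. -/
def mulOp (f : Poly) : Op := LinearMap.mulLeft ℂ f

/-- The operator `ℒ = 𝒟_1² - 2 b_{1,1}`. -/
def opL : Op := opD 0 ^ 2 - mulOp (2 * b1 0)

/-- For `k ≥ 1`, `opB k` is the polynomial Buchstaber–Shorina operator
`ℬ_{2k+1} = 𝒟_{2k-1} 𝒟_1² - (b_{1,1} 𝒟_{2k-1} + 𝒟_{2k-1} b_{1,1})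
  - (1/2) (b_{1,2k-1} 𝒟_1 + 𝒟_1 b_{1,2k-1}) - 𝒟_{2k+1}`. -/
def opB (k : ℕ) : Op :=
  opD (k - 1) * opD 0 ^ 2 - (mulOp (b1 0) * opD (k - 1) + opD (k - 1) * mulOp (b1 0))
    - (1 / 2 : ℂ) • (mulOp (b1 (k - 1)) * opD 0 + opD 0 * mulOp (b1 (k - 1))) - opD k

/-- `opA k` is the operator `𝒜_{2k+1}`, given recursively by
`𝒜_{2k+1} = ∑_{j=1}^k ℬ_{2j+1} ℒ^{k-j} + 𝒟_{2k+1} - ∑_{j=0}^{k-2} a_{2k-2j} 𝒜_{2j+1}`. -/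
def opA (k : ℕ) : Op :=
  (∑ j ∈ Finset.Icc 1 k, opB j * opL ^ (k - j)) + opD k
    - ∑ j : Fin (k - 1), mulOp (par (k - j.1)) * opA j.1
termination_by k
decreasing_by have := j.2; omega

/-! ### The defining relations hold -/

/-- The defining relation of `par`. -/
theorem two_mul_par (k : ℕ) : 2 * par (k + 1)
    = lam k - ∑ i ∈ Finset.Icc 1 (k - 2), par (i + 1) * par (k - i) := by
  rw [par, ← mul_assoc, Fin.sum_univ_eq_sum_range (fun i => par (i + 2) * par (k - (i + 1))),
    Finset.sum_bij (s := Finset.range (k - 2)) (t := Finset.Icc 1 (k - 2))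
      (g := fun i => par (i + 1) * par (k - i)) (fun i _ => i + 1)]
  · have : (2 : Poly) * MvPolynomial.C (1 / 2) = 1 := by
      rw [← map_ofNat (MvPolynomial.C : ℂ →+* Poly) 2, ← map_mul]; norm_num
    rw [this, one_mul]
  · intro i hi
    simp only [Finset.mem_range, Finset.mem_Icc] at *
    omega
  · intro i _ j _ h
    omega
  · intro j hj
    simp only [Finset.mem_range, Finset.mem_Icc] at *
    exact ⟨j - 1, by omega, by omega⟩
  · intro i _
    rfl

/-- The defining relation of `opA`. -/
theorem opA_eq (k : ℕ) : opA k = (∑ j ∈ Finset.Icc 1 k, opB j * opL ^ (k - j)) + opD k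
    - ∑ j ∈ Finset.range (k - 1), mulOp (par (k - j)) * opA j := by
  rw [opA, Fin.sum_univ_eq_sum_range (fun j => mulOp (par (k - j)) * opA j)]

theorem four_mul_lam (j : ℕ) : 4 * lam j = PowerSeries.coeff (j + 1) mxRhs := by
  have : (4 : Poly) * MvPolynomial.C (1 / 4) = 1 := by
    rw [← map_ofNat (MvPolynomial.C : ℂ →+* Poly) 4, ← map_mul]; norm_num
  rw [lam, ← mul_assoc, this, one_mul]

/-- The relation that defines the `λ_{2j+2}`, multiplied by `ξ`. -/
theorem four_mul_mxLhs : 4 * mxLhs = mxRhs := by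
  obtain ⟨G, hG⟩ : ∃ G, genSeries b1
      = PowerSeries.X * (PowerSeries.C (b1 0) + PowerSeries.X * G) := by
    refine ⟨PowerSeries.mk fun n => b1 (n + 1), ?_⟩
    rw [genSeries]
    congr 1
    ext n
    cases n <;> simp [PowerSeries.coeff_succ_X_mul]
  obtain ⟨H, hH⟩ : ∃ H, mxRhs = 4 + PowerSeries.X ^ 2 * H := by
    refine ⟨PowerSeries.X * PowerSeries.mk b2 ^ 2
      + 2 * PowerSeries.mk b3 * (1 - genSeries b1)
      + 4 * (PowerSeries.C (b1 0) + PowerSeries.X * G) ^ 2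
      - 8 * G
      + 8 * PowerSeries.C (b1 0) * (-2 * (PowerSeries.C (b1 0) + PowerSeries.X * G)
        + PowerSeries.X * (PowerSeries.C (b1 0) + PowerSeries.X * G) ^ 2), ?_⟩
    rw [mxRhs, hG, genSeries, genSeries]
    ring
  have h : (4 : PowerSeries Poly) * (PowerSeries.mk fun i => lam (i + 1)) = H := by
    ext n : 1
    rw [← map_ofNat (PowerSeries.C : Poly →+* PowerSeries Poly) 4, PowerSeries.coeff_C_mul,
      PowerSeries.coeff_mk, four_mul_lam, hH, ← map_ofNat (PowerSeries.C : Poly →+* _) 4,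
      map_add, PowerSeries.coeff_C, if_neg (by omega), zero_add,
      show n + 1 + 1 = n + 2 from rfl, PowerSeries.coeff_X_pow_mul]
  rw [hH, ← h, mxLhs]
  ring

/-- The coefficient of `ξ^m η^n`. -/
def coeff2 (m n : ℕ) : Series2 →+ Poly :=
  (PowerSeries.coeff m (R := Poly)).toAddMonoidHom.comp
    (PowerSeries.coeff n (R := PowerSeries Poly)).toAddMonoidHom

theorem coeff2_apply (m n : ℕ) (N : Series2) :
    coeff2 m n N = PowerSeries.coeff m (PowerSeries.coeff n N) := rfl

theorem coeff2_inXi_mul_inEta (f g : PowerSeries Poly) (m n : ℕ) :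
    coeff2 m n (inXi f * inEta g) = PowerSeries.coeff m f * PowerSeries.coeff n g := by
  rw [coeff2_apply, inXi, inEta, PowerSeries.coeff_C_mul, PowerSeries.coeff_map,
    PowerSeries.coeff_mul_C]

theorem coeff2_xi_mul (N : Series2) (m n : ℕ) :
    coeff2 m n (xi * N) = if m = 0 then 0 else coeff2 (m - 1) n N := by
  rw [coeff2_apply, xi, inXi, PowerSeries.coeff_C_mul]
  cases m <;> simp [PowerSeries.coeff_succ_X_mul, coeff2_apply]

theorem coeff2_eta_mul (N : Series2) (m n : ℕ) :
    coeff2 m n (eta * N) = if n = 0 then 0 else coeff2 m (n - 1) N := by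
  rw [coeff2_apply, eta]
  cases n <;> simp [PowerSeries.coeff_succ_X_mul, coeff2_apply]

theorem coeff2_const2_mul (f : Poly) (N : Series2) (m n : ℕ) :
    coeff2 m n (const2 f * N) = f * coeff2 m n N := by
  rw [coeff2_apply, const2, PowerSeries.coeff_C_mul, PowerSeries.coeff_C_mul, coeff2_apply]

/-- The restriction of a series to the diagonal `η = ξ`. -/
def diag : Series2 →+ PowerSeries Poly where
  toFun N := PowerSeries.mk fun d => ∑ x ∈ Finset.HasAntidiagonal.antidiagonal d, coeff2 x.1 x.2 N
  map_zero' := by ext; simp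
  map_add' M N := by ext; simp [Finset.sum_add_distrib]

theorem coeff_diag (d : ℕ) (N : Series2) :
    PowerSeries.coeff d (diag N) = ∑ x ∈ Finset.HasAntidiagonal.antidiagonal d, coeff2 x.1 x.2 N := by
  simp [diag]

theorem diag_inXi_mul_inEta (f g : PowerSeries Poly) : diag (inXi f * inEta g) = f * g := by
  ext d : 1
  rw [coeff_diag, PowerSeries.coeff_mul]
  simp only [coeff2_inXi_mul_inEta]

theorem diag_xi_mul (N : Series2) : diag (xi * N) = PowerSeries.X * diag N := by
  ext d : 1
  rw [coeff_diag]
  cases d with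
  | zero => simp [coeff2_xi_mul]
  | succ d =>
    rw [PowerSeries.coeff_succ_X_mul, coeff_diag, Finset.Nat.sum_antidiagonal_succ]
    simp [coeff2_xi_mul]

theorem diag_eta_mul (N : Series2) : diag (eta * N) = PowerSeries.X * diag N := by
  ext d : 1
  rw [coeff_diag]
  cases d with
  | zero => simp [coeff2_eta_mul]
  | succ d =>
    rw [PowerSeries.coeff_succ_X_mul, coeff_diag, Finset.Nat.sum_antidiagonal_succ']
    simp [coeff2_eta_mul]

theorem diag_const2_mul (f : Poly) (N : Series2) :
    diag (const2 f * N) = PowerSeries.C f * diag N := by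
  ext d : 1
  simp only [coeff_diag, coeff2_const2_mul, PowerSeries.coeff_C_mul, Finset.mul_sum]

/-- A series that is symmetric in `ξ` and `η`. -/
def IsSymm2 (N : Series2) : Prop := ∀ m n, coeff2 m n N = coeff2 n m N

theorem IsSymm2.add' {M N : Series2} (hM : IsSymm2 M) (hN : IsSymm2 N) : IsSymm2 (M + N) :=
  fun m n => by rw [map_add, map_add, hM, hN]

theorem IsSymm2.sub' {M N : Series2} (hM : IsSymm2 M) (hN : IsSymm2 N) : IsSymm2 (M - N) :=
  fun m n => by rw [map_sub, map_sub, hM, hN]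

theorem IsSymm2.const_mul {N : Series2} (hN : IsSymm2 N) (f : Poly) :
    IsSymm2 (const2 f * N) :=
  fun m n => by rw [coeff2_const2_mul, coeff2_const2_mul, hN]

theorem IsSymm2.xi_eta_mul {N : Series2} (hN : IsSymm2 N) : IsSymm2 (xi * (eta * N)) := by
  intro m n
  simp only [coeff2_xi_mul, coeff2_eta_mul]
  rw [hN]
  split_ifs <;> rfl

theorem IsSymm2.xi_add_eta_mul {N : Series2} (hN : IsSymm2 N) :
    IsSymm2 (xi * N + eta * N) := by
  intro m n
  simp only [map_add, coeff2_xi_mul, coeff2_eta_mul]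
  rw [hN, hN m, add_comm]

theorem isSymm2_tensor (f g : PowerSeries Poly) :
    IsSymm2 (inXi f * inEta g + inXi g * inEta f) := by
  intro m n
  simp only [map_add, coeff2_inXi_mul_inEta]
  ring

theorem isSymm2_tensor_self (f : PowerSeries Poly) : IsSymm2 (inXi f * inEta f) := by
  intro m n
  simp only [coeff2_inXi_mul_inEta]
  ring

theorem coeff2_mk_monomial (c : ℕ → Poly) (m n : ℕ) :
    coeff2 m n (PowerSeries.mk fun i => PowerSeries.monomial i (c i))
      = if m = n then c m else 0 := by
  rw [coeff2_apply, PowerSeries.coeff_mk, PowerSeries.coeff_monomial]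
  split_ifs with h
  · rw [h]
  · rfl

theorem isSymm2_mk_monomial (c : ℕ → Poly) :
    IsSymm2 (PowerSeries.mk fun i => PowerSeries.monomial i (c i)) := by
  intro m n
  rw [coeff2_mk_monomial, coeff2_mk_monomial]
  by_cases h : m = n
  · rw [h]
  · rw [if_neg h, if_neg (Ne.symm h)]

theorem coeff_diag_mk_monomial (c : ℕ → Poly) (d : ℕ) :
    PowerSeries.coeff d (diag (PowerSeries.mk fun i => PowerSeries.monomial i (c i)))
      = if Even d then c (d / 2) else 0 := by
  rw [coeff_diag]
  simp only [coeff2_mk_monomial]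
  split_ifs with h
  · obtain ⟨r, rfl⟩ := h
    rw [Finset.sum_eq_single (r, r)]
    · simp only [if_true]
      congr 1
      omega
    · rintro ⟨x, y⟩ hx hne
      rw [Finset.HasAntidiagonal.mem_antidiagonal] at hx
      rw [if_neg]
      rintro h
      apply hne
      simp only at hx h
      ext <;> simp only <;> omega
    · intro h'
      simp at h'
  · apply Finset.sum_eq_zero
    rintro ⟨x, y⟩ hx
    rw [Finset.HasAntidiagonal.mem_antidiagonal] at hx
    rw [if_neg]
    rintro h'
    apply h
    simp only at hx h'
    exact ⟨x, by omega⟩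

theorem diag_lamSeries : diag lamSeriesOdd + PowerSeries.X * diag lamSeriesEven
    = PowerSeries.X * PowerSeries.mk fun i => lam (i + 1) := by
  ext d : 1
  rw [map_add, lamSeriesOdd, lamSeriesEven, coeff_diag_mk_monomial]
  cases d with
  | zero => simp
  | succ d =>
    rw [PowerSeries.coeff_succ_X_mul, PowerSeries.coeff_succ_X_mul, coeff_diag_mk_monomial,
      PowerSeries.coeff_mk]
    rcases Nat.even_or_odd d with h | h
    · rw [if_pos h, if_neg (by simpa [Nat.even_add_one] using h), zero_add,
        Nat.two_mul_div_two_of_even h]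
    · have h' : Even (d + 1) := h.add_one
      rw [if_neg (Nat.not_even_iff_odd.mpr h), if_pos h', add_zero, Nat.two_mul_div_two_of_even h',
        if_neg]
      obtain ⟨r, rfl⟩ := h
      omega

theorem inXi_sub (f g : PowerSeries Poly) : inXi (f - g) = inXi f - inXi g := map_sub _ _ _

theorem inEta_sub (f g : PowerSeries Poly) : inEta (f - g) = inEta f - inEta g := map_sub _ _ _

theorem const2_ofNat (n : ℕ) [n.AtLeastTwo] :
    const2 (OfNat.ofNat n) = (OfNat.ofNat n : Series2) := by
  rw [const2, map_ofNat, map_ofNat]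

theorem inXi_one : inXi 1 = 1 := map_one _

theorem inEta_one : inEta 1 = 1 := map_one _

theorem qSeries_eq : qSeries
    = xi * (eta * (inXi (genSeries b2) * inEta (genSeries b2)))
      + xi * (eta * (inXi (1 - genSeries b1) * inEta (genSeries b3)
          + inXi (genSeries b3) * inEta (1 - genSeries b1)))
      + const2 2 * (xi * (inXi (1 - genSeries b1) * inEta (1 - genSeries b1))
          + eta * (inXi (1 - genSeries b1) * inEta (1 - genSeries b1)))
      + const2 (8 * b1 0) * (xi * (eta *
          (inXi (1 - genSeries b1) * inEta (1 - genSeries b1)))) := by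
  have h2 : const2 2 = 2 := const2_ofNat 2
  have h8 : const2 (8 * b1 0) = 8 * const2 (b1 0) := by
    rw [const2, map_mul, map_mul, map_ofNat, map_ofNat]
    rfl
  rw [h2, h8, qSeries]
  simp only [inXi_sub, inEta_sub, inXi_one, inEta_one]
  ring

theorem numSeries_eq' : numSeries
    = const2 2 * (xi * (inXi 1 * inEta 1) + eta * (inXi 1 * inEta 1))
      + const2 4 * (xi * (eta * lamSeriesOdd))
      + const2 2 * (xi * (eta * (xi * lamSeriesEven + eta * lamSeriesEven)))
      - qSeries := by
  have h2 : const2 2 = 2 := const2_ofNat 2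
  have h4 : const2 4 = 4 := const2_ofNat 4
  rw [h2, h4, numSeries, inXi_one, inEta_one]
  ring

theorem isSymm2_numSeries : IsSymm2 numSeries := by
  rw [numSeries_eq', qSeries_eq]
  refine .sub' (.add' (.add' (.const_mul (.xi_add_eta_mul (isSymm2_tensor_self _)) _)
    (.const_mul (.xi_eta_mul (isSymm2_mk_monomial _)) _))
    (.const_mul (.xi_eta_mul (.xi_add_eta_mul (isSymm2_mk_monomial _))) _))
    (.add' (.add' (.add' (.xi_eta_mul (isSymm2_tensor_self _))
      (.xi_eta_mul (isSymm2_tensor _ _)))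
      (.const_mul (.xi_add_eta_mul (isSymm2_tensor_self _)) _))
      (.const_mul (.xi_eta_mul (isSymm2_tensor_self _)) _))

theorem diag_numSeries : diag numSeries = 0 := by
  rw [numSeries_eq', qSeries_eq]
  simp only [map_add, map_sub, diag_xi_mul, diag_eta_mul, diag_const2_mul, diag_inXi_mul_inEta]
  have h1 := diag_lamSeries
  have h2 := four_mul_mxLhs
  rw [mxLhs, mxRhs] at h2
  simp only [map_mul, map_ofNat]
  linear_combination (4 * PowerSeries.X ^ 2) * h1 + PowerSeries.X * h2

theorem sum_numCoeff (d : ℕ) : ∑ k ∈ Finset.range (d + 1), numCoeff k (d - k) = 0 := by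
  have h := coeff_diag d numSeries
  rw [diag_numSeries, map_zero, Finset.Nat.sum_antidiagonal_eq_sum_range_succ_mk] at h
  exact h.symm

theorem sum_mul_numCoeff (d : ℕ) :
    ∑ k ∈ Finset.range (d + 1), (k : Poly) * numCoeff k (d - k) = 0 := by
  set S := ∑ k ∈ Finset.range (d + 1), (k : Poly) * numCoeff k (d - k) with hS
  have h : S = ∑ k ∈ Finset.range (d + 1), ((d : Poly) - k) * numCoeff k (d - k) := by
    rw [hS, ← Finset.sum_range_reflect]
    refine Finset.sum_congr rfl fun k hk => ?_
    rw [Finset.mem_range] at hk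
    have e : d + 1 - 1 - k = d - k := by omega
    rw [e, Nat.sub_sub_self (by omega), Nat.cast_sub (by omega)]
    congr 1
    exact isSymm2_numSeries _ _
  have h2 : S + S = 0 := by
    nth_rewrite 2 [h]
    rw [hS, ← Finset.sum_add_distrib, ← mul_zero (d : Poly), ← sum_numCoeff d, Finset.mul_sum]
    exact Finset.sum_congr rfl fun k _ => by ring
  rw [← two_mul] at h2
  exact (mul_eq_zero.mp h2).resolve_left two_ne_zero

/-- The sums that define `p`, with a shift of the indices. -/
def shiftSum (m n : ℕ) : Poly :=
  ∑ k ∈ Finset.range (n + 1), ((k : Poly) + 1) * numCoeff (m + k) (n - k)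

theorem shiftSum_zero (n : ℕ) : shiftSum 0 n = 0 := by
  have h : shiftSum 0 n = ∑ k ∈ Finset.range (n + 1), (k : Poly) * numCoeff k (n - k)
      + ∑ k ∈ Finset.range (n + 1), numCoeff k (n - k) := by
    rw [shiftSum, ← Finset.sum_add_distrib]
    exact Finset.sum_congr rfl fun k _ => by rw [zero_add]; ring
  rw [h, sum_mul_numCoeff, sum_numCoeff, add_zero]

theorem shiftSum_one (n : ℕ) : shiftSum 1 n = 0 := by
  have h := sum_mul_numCoeff (n + 1)
  rw [Finset.sum_range_succ'] at h
  rw [← h, shiftSum]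
  simp only [Nat.cast_zero, zero_mul, add_zero]
  refine Finset.sum_congr rfl fun k _ => ?_
  rw [Nat.cast_add, Nat.cast_one, add_comm 1 k, Nat.add_sub_add_right]

theorem shift_rec {R : Type*} [CommRing R] (c : ℕ → ℕ → R) (S : ℕ → ℕ → R)
    (hS : ∀ m n, S m n = ∑ k ∈ Finset.range (n + 1), ((k : R) + 1) * c (m + k) (n - k))
    (m n : ℕ) : S m (n + 2) - 2 * S (m + 1) (n + 1) + S (m + 2) n = c m (n + 2) := by
  have e1 : S m (n + 2) = ∑ k ∈ Finset.range (n + 1),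
      ((k : R) + 3) * c (m + (k + 2)) (n - k)
      + 2 * c (m + 1) (n + 1) + c m (n + 2) := by
    rw [hS, Finset.sum_range_succ', Finset.sum_range_succ']
    congr 1
    · congr 1
      · refine Finset.sum_congr rfl fun k _ => ?_
        rw [show n + 2 - (k + 1 + 1) = n - k by omega, show k + 1 + 1 = k + 2 from rfl]
        push_cast
        ring
      · push_cast
        ring
    · simp
  have e2 : S (m + 1) (n + 1) = ∑ k ∈ Finset.range (n + 1),
      ((k : R) + 2) * c (m + (k + 2)) (n - k) + c (m + 1) (n + 1) := by
    rw [hS, Finset.sum_range_succ']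
    congr 1
    · refine Finset.sum_congr rfl fun k _ => ?_
      rw [show n + 1 - (k + 1) = n - k by omega, show m + 1 + (k + 1) = m + (k + 2) by omega]
      push_cast
      ring
    · simp
  have e3 : S (m + 2) n = ∑ k ∈ Finset.range (n + 1),
      ((k : R) + 1) * c (m + (k + 2)) (n - k) := by
    rw [hS]
    refine Finset.sum_congr rfl fun k _ => ?_
    rw [show m + 2 + k = m + (k + 2) by omega]
  have e4 : ∑ k ∈ Finset.range (n + 1), ((k : R) + 3) * c (m + (k + 2)) (n - k)
      - 2 * ∑ k ∈ Finset.range (n + 1), ((k : R) + 2) * c (m + (k + 2)) (n - k)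
      + ∑ k ∈ Finset.range (n + 1), ((k : R) + 1) * c (m + (k + 2)) (n - k) = 0 := by
    rw [Finset.mul_sum, ← Finset.sum_sub_distrib, ← Finset.sum_add_distrib]
    exact Finset.sum_eq_zero fun k _ => by ring
  rw [e1, e2, e3]
  linear_combination e4

theorem shiftSum_rec (m n : ℕ) : shiftSum m (n + 2) - 2 * shiftSum (m + 1) (n + 1)
    + shiftSum (m + 2) n = numCoeff m (n + 2) :=
  shift_rec numCoeff shiftSum (fun _ _ => rfl) m n

theorem shiftSum_right_zero (m : ℕ) : shiftSum m 0 = numCoeff m 0 := by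
  rw [shiftSum, Finset.sum_range_one, Nat.cast_zero, zero_add, one_mul, add_zero]

theorem shiftSum_right_one (m : ℕ) :
    shiftSum m 1 = numCoeff m 1 + 2 * numCoeff (m + 1) 0 := by
  rw [shiftSum, Finset.sum_range_succ, Finset.sum_range_one, Nat.cast_zero, zero_add, one_mul,
    add_zero, Nat.cast_one, one_add_one_eq_two, Nat.sub_self, Nat.sub_zero]

theorem p_eq_shiftSum (m n : ℕ) : p m n = shiftSum (m + 2) n := rfl

/-- The relation that defines the `p_{s,k}`, divided by `ξ η`. -/
theorem numSeries_eq :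
    (xi - eta) ^ 2 * (PowerSeries.mk fun n => PowerSeries.mk fun m => p m n) = numSeries := by
  set Q : Series2 := PowerSeries.mk fun n => PowerSeries.mk fun m => p m n with hQ
  have hc : ∀ m n, coeff2 m n Q = shiftSum (m + 2) n := fun m n => by
    rw [coeff2_apply, hQ, PowerSeries.coeff_mk, PowerSeries.coeff_mk, p_eq_shiftSum]
  have e : (xi - eta) ^ 2 * Q
      = xi * (xi * Q) - const2 2 * (xi * (eta * Q)) + eta * (eta * Q) := by
    have h2 : const2 2 = 2 := const2_ofNat 2
    rw [h2]
    ring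
  have h1 : ∀ m n, coeff2 m n (xi * (xi * Q)) = shiftSum m n := by
    intro m n
    rw [coeff2_xi_mul, coeff2_xi_mul, hc]
    rcases m with _ | _ | m <;> simp [shiftSum_zero, shiftSum_one]
  have h2 : ∀ m n, coeff2 m n (xi * (eta * Q))
      = if n = 0 then 0 else shiftSum (m + 1) (n - 1) := by
    intro m n
    rw [coeff2_xi_mul, coeff2_eta_mul, hc]
    rcases m with _ | m <;> simp [shiftSum_one]
  rw [e]
  ext n m : 2
  rw [← coeff2_apply, ← coeff2_apply, map_add, map_sub, h1, coeff2_const2_mul, h2,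
    coeff2_eta_mul, coeff2_eta_mul, hc, coeff2_apply m n numSeries, ← numCoeff]
  rcases n with _ | _ | n
  · rw [if_pos rfl, if_pos rfl, mul_zero, sub_zero, add_zero, shiftSum_right_zero]
  · rw [if_neg (by omega), if_neg (by omega), if_pos rfl, add_zero, zero_add, Nat.sub_self,
      shiftSum_right_one, shiftSum_right_zero, add_sub_cancel_right]
  · rw [if_neg (by omega), if_neg (by omega), if_neg (by omega)]
    exact shiftSum_rec m n

/-- The values `p_{2m+1,1} = 2 b_{1,2m+1}`. -/
theorem p_zero_right (m : ℕ) : p m 0 = 2 * b1 m := by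
  rw [p_eq_shiftSum, shiftSum_right_zero, numCoeff, ← coeff2_apply, numSeries_eq', qSeries_eq]
  simp only [map_add, map_sub, coeff2_const2_mul, coeff2_xi_mul, coeff2_eta_mul,
    coeff2_inXi_mul_inEta]
  have h : ∀ n, PowerSeries.coeff (n + 1) (genSeries b1) = b1 n := fun n => by
    rw [genSeries, PowerSeries.coeff_succ_X_mul, PowerSeries.coeff_mk]
  have h0 : PowerSeries.coeff 0 (genSeries b1) = 0 := by
    rw [genSeries, PowerSeries.coeff_zero_X_mul]
  simp [h, h0, PowerSeries.coeff_one, -PowerSeries.coeff_zero_eq_constantCoeff]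

end PolyKdV

end

noncomputable section

namespace PolyKdV

/-! ### Derivations acting on the coefficients of power series -/

/-! By the recursion that defines `𝒜_{2k+1}`, the terms with the parameters `a` cancel in the second
entry of the commutator, leaving `∑ ℬ_{2j+1} ℒ^{k-j} + 𝒟_{2k+1}`. So two facts suffice: `[ℒ,
𝒟_{2k+1}]` is multiplication by `𝒟_{2k+1}(2 b_{1,1})` (`lie_opL_opD`), and every `ℬ_{2j+1}` commutes
with `ℒ` (`lie_opL_opB`).

The first fact reduces to `[𝒟_1, 𝒟_s] = 0` (`lie_D₁_D`), the core of the proof. On `b_{1,n}` and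
`b_{2,n}` this is built into `𝒟_s`; on `b_{3,n}` it is a fourth-order equation for `p_{s,n}`
(`D₁_four_p`). That equation is proved for the generating series. With `u = b_{1,1}`, the definition
of `𝒟_1` says that `y = 1 - 𝐛₁(ξ)` solves `y''' = 4(ξ⁻¹ + 2u) y' + 4u' y`. The series of the `λ` is
a first integral of this equation, so `𝒟_1` kills the `λ`, and differentiating `(ξ - η)² P = …`,
where `P` is the series of the `p_{s,k}`, gives a closed formula for `(ξ - η) 𝒟_1 P`, from which the
higher derivatives follow.

The second fact uses `ℬ_{2k+3} = 𝒟_{2k+1} ℒ - b_{1,2k+1} 𝒟_1 + ½ b_{2,2k+1} - 𝒟_{2k+3}`: its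
commutator with `ℒ` reduces to a multiplication operator, which vanishes by the formula for
`𝒟_1(b_{3,2k+1})`. -/

/-- A derivation of `R`, extended to power series over `R` coefficient by coefficient. -/
def liftDer {R : Type*} [CommRing R] [Algebra ℂ R] (d : Derivation ℂ R R) :
    Derivation ℂ (PowerSeries R) (PowerSeries R) :=
  Derivation.mk'
    { toFun := fun f => PowerSeries.mk fun n => d (PowerSeries.coeff n f)
      map_add' := fun f g => by ext; simp
      map_smul' := fun c f => by ext; simp }
    (fun f g => by
      ext n
      simp only [LinearMap.coe_mk, AddHom.coe_mk, PowerSeries.coeff_mk, smul_eq_mul, map_add,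
        PowerSeries.coeff_mul, map_sum, Derivation.leibniz]
      rw [Finset.sum_add_distrib]
      congr 1
      -- The Leibniz rule writes its second term with the two factors interchanged, so this sum is
      -- reindexed by reflecting the antidiagonal.
      exact Finset.sum_equiv (Equiv.prodComm ℕ ℕ)
        (fun x => by simp [add_comm]) (fun x _ => rfl))

section LiftDer

variable {R : Type*} [CommRing R] [Algebra ℂ R] (d : Derivation ℂ R R)

theorem coeff_liftDer (n : ℕ) (f : PowerSeries R) :
    PowerSeries.coeff n (liftDer d f) = d (PowerSeries.coeff n f) := by
  simp [liftDer]

theorem liftDer_mk (f : ℕ → R) :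
    liftDer d (PowerSeries.mk f) = PowerSeries.mk fun n => d (f n) := by
  ext n
  simp [coeff_liftDer]

theorem liftDer_C (a : R) : liftDer d (PowerSeries.C a) = PowerSeries.C (d a) := by
  ext n
  rw [coeff_liftDer, PowerSeries.coeff_C, PowerSeries.coeff_C]
  split_ifs <;> simp

theorem liftDer_X : liftDer d PowerSeries.X = 0 := by
  ext n
  rw [coeff_liftDer, PowerSeries.coeff_X]
  split_ifs <;> simp

end LiftDer

theorem derivation_ofNat {A : Type*} [CommRing A] [Algebra ℂ A] (d : Derivation ℂ A A) (n : ℕ)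
    [n.AtLeastTwo] : d (OfNat.ofNat n) = 0 :=
  d.map_natCast n

theorem derivation_two {A : Type*} [CommRing A] [Algebra ℂ A] (d : Derivation ℂ A A) :
    d 2 = 0 :=
  derivation_ofNat d 2

theorem derivation_four {A : Type*} [CommRing A] [Algebra ℂ A] (d : Derivation ℂ A A) :
    d 4 = 0 :=
  derivation_ofNat d 4

theorem derivation_eight {A : Type*} [CommRing A] [Algebra ℂ A] (d : Derivation ℂ A A) :
    d 8 = 0 :=
  derivation_ofNat d 8

/-! ### The action of `𝒟_1` on series -/

/-- `𝒟_1` on series in one variable. -/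
def del1 : Derivation ℂ (PowerSeries Poly) (PowerSeries Poly) := liftDer D₁

/-- `𝒟_1` on series in two variables. -/
def del2 : Derivation ℂ Series2 Series2 := liftDer del1

theorem D₁_b1 (n : ℕ) : D₁ (b1 n) = b2 n := by
  simp [D₁, vectorField, b1, MvPolynomial.mkDerivation_X]

theorem D₁_b2 (n : ℕ) : D₁ (b2 n) = b3 n := by
  simp [D₁, vectorField, b2, MvPolynomial.mkDerivation_X]

theorem D₁_b3 (n : ℕ) :
    D₁ (b3 n) = 4 * (2 * b1 0 * b2 n + b2 0 * b1 n + b2 (n + 1)) := by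
  simp [D₁, vectorField, b3, MvPolynomial.mkDerivation_X]

theorem del1_X : del1 PowerSeries.X = 0 := liftDer_X _

theorem del1_C (f : Poly) : del1 (PowerSeries.C f) = PowerSeries.C (D₁ f) := liftDer_C _ _

theorem del1_mk_b1 : del1 (PowerSeries.mk b1) = PowerSeries.mk b2 := by
  simp only [del1, liftDer_mk, D₁_b1]

theorem del1_mk_b2 : del1 (PowerSeries.mk b2) = PowerSeries.mk b3 := by
  simp only [del1, liftDer_mk, D₁_b2]

/-- The third order equation for `𝐛₁`, as a relation for the series `∑ b_{3,2n+1} ξ^n`. -/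
theorem X_mul_del1_mk_b3 : PowerSeries.X * del1 (PowerSeries.mk b3)
    = 4 * ((2 * PowerSeries.C (b1 0) * PowerSeries.X + 1) * PowerSeries.mk b2
      + PowerSeries.C (b2 0) * (PowerSeries.X * PowerSeries.mk b1 - 1)) := by
  -- The term `b2 (n + 1)` in `D₁ (b3 n)` is a shift; multiplying by `ξ` undoes it except for the
  -- constant term, which produces the `-1` in the statement.
  have h : PowerSeries.mk b2
      = PowerSeries.X * (PowerSeries.mk fun n => b2 (n + 1)) + PowerSeries.C (b2 0) := by
    ext n : 1
    cases n <;> simp [PowerSeries.coeff_succ_X_mul]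
  have h3 : del1 (PowerSeries.mk b3) = 4 * (2 * PowerSeries.C (b1 0) * PowerSeries.mk b2
      + PowerSeries.C (b2 0) * PowerSeries.mk b1 + PowerSeries.mk fun n => b2 (n + 1)) := by
    rw [del1, liftDer_mk]
    ext n : 1
    rw [← map_ofNat (PowerSeries.C : Poly →+* PowerSeries Poly) 4,
      ← map_ofNat (PowerSeries.C : Poly →+* PowerSeries Poly) 2, ← map_mul]
    simp only [PowerSeries.coeff_mk, PowerSeries.coeff_C_mul, map_add, D₁_b3]
  rw [h3]
  linear_combination (-4) * h

/-- With `y = 1 - 𝐛₁(ξ)` the series is `ξ` times `y'² - 2 y y'' + 4 (ξ⁻¹ + 2u) y²`. Its derivative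
is a multiple of the third-order equation for `y`, the multiplier being `-2 ξ y`. -/
theorem del1_mxRhs : del1 mxRhs = 0 := by
  have h := X_mul_del1_mk_b3
  simp only [mxRhs, genSeries, pow_two, map_add, map_sub, Derivation.leibniz, smul_eq_mul, del1_X,
    del1_C, del1_mk_b1, del1_mk_b2, Derivation.map_one_eq_zero, derivation_two, derivation_four, D₁_b1]
  linear_combination (2 * PowerSeries.X * (1 - PowerSeries.X * PowerSeries.mk b1)) * h

theorem D₁_lam (j : ℕ) : D₁ (lam j) = 0 := by
  have h := coeff_liftDer D₁ (j + 1) mxRhs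
  rw [← del1, del1_mxRhs, ← four_mul_lam, Derivation.leibniz, derivation_four] at h
  simpa using h.symm

theorem del2_inXi (f : PowerSeries Poly) : del2 (inXi f) = inXi (del1 f) := liftDer_C _ _

theorem del2_inEta (f : PowerSeries Poly) : del2 (inEta f) = inEta (del1 f) := by
  ext n : 1
  rw [del2, coeff_liftDer, inEta, inEta, PowerSeries.coeff_map, PowerSeries.coeff_map, del1_C,
    del1, coeff_liftDer]

theorem del2_xi : del2 xi = 0 := by
  rw [xi, del2_inXi, del1_X, inXi, map_zero]

theorem del2_eta : del2 eta = 0 := liftDer_X _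

theorem del2_const2 (f : Poly) : del2 (const2 f) = const2 (D₁ f) := by
  rw [const2, ← inXi, del2_inXi, del1_C]
  rfl

theorem coeff2_del2 (m n : ℕ) (N : Series2) : coeff2 m n (del2 N) = D₁ (coeff2 m n N) := by
  rw [coeff2_apply, del2, coeff_liftDer, del1, coeff_liftDer, coeff2_apply]

theorem series2_ext {M N : Series2} (h : ∀ m n, coeff2 m n M = coeff2 m n N) : M = N := by
  ext n m : 2
  exact h m n

theorem del2_lamSeriesOdd : del2 lamSeriesOdd = 0 := by
  refine series2_ext fun m n => ?_
  rw [coeff2_del2, lamSeriesOdd, coeff2_mk_monomial, map_zero]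
  split_ifs <;> simp [D₁_lam]

theorem del2_lamSeriesEven : del2 lamSeriesEven = 0 := by
  refine series2_ext fun m n => ?_
  rw [coeff2_del2, lamSeriesEven, coeff2_mk_monomial, map_zero]
  split_ifs <;> simp [D₁_lam]

/-! ### The series of the `p_{s,k}` and its derivatives -/

/-- The series `∑ p_{2m+1,2n+1} ξ^m η^n`. -/
def pSeries : Series2 := PowerSeries.mk fun n => PowerSeries.mk fun m => p m n

/-- The series `∑ p_{2m+1,2n+3} ξ^m η^n`. -/
def pShift : Series2 := PowerSeries.mk fun n => PowerSeries.mk fun m => p m (n + 1)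

theorem coeff2_pSeries (m n : ℕ) : coeff2 m n pSeries = p m n := by
  rw [coeff2_apply, pSeries, PowerSeries.coeff_mk, PowerSeries.coeff_mk]

theorem coeff2_pShift (m n : ℕ) : coeff2 m n pShift = p m (n + 1) := by
  rw [coeff2_apply, pShift, PowerSeries.coeff_mk, PowerSeries.coeff_mk]

/-- Since `p_{2m+1,1} = 2 b_{1,2m+1}`, the index shift caused by `b2 (n + 1)` in `D₁ (b3 n)` becomes
division by `η` up to an explicit term. -/
theorem pSeries_eq : pSeries = eta * pShift + 2 * inXi (PowerSeries.mk b1) := by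
  refine series2_ext fun m n => ?_
  have h2 : (2 : Series2) = const2 2 := (const2_ofNat 2).symm
  rw [h2, map_add, coeff2_eta_mul, coeff2_const2_mul, coeff2_pSeries, inXi]
  cases n with
  | zero => simp [coeff2_apply, p_zero_right]
  | succ n => simp [coeff2_apply, pShift]

theorem xi_sub_eta_ne_zero : xi - eta ≠ 0 := by
  intro h
  have h' := congrArg (coeff2 1 0) h
  rw [map_sub, ← mul_one xi, ← mul_one eta, coeff2_xi_mul, coeff2_eta_mul, map_zero] at h'
  simp [coeff2_apply] at h'

theorem inXi_X_mul (f : PowerSeries Poly) : inXi (PowerSeries.X * f) = xi * inXi f :=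
  map_mul _ _ _

theorem inEta_X_mul (f : PowerSeries Poly) : inEta (PowerSeries.X * f) = eta * inEta f := by
  rw [inEta, map_mul, PowerSeries.map_X]
  rfl

theorem xi_mul_del2_b3 : xi * del2 (inXi (PowerSeries.mk b3))
    = 4 * ((2 * const2 (b1 0) * xi + 1) * inXi (PowerSeries.mk b2)
      + const2 (b2 0) * (xi * inXi (PowerSeries.mk b1) - 1)) := by
  rw [del2_inXi, ← inXi_X_mul, X_mul_del1_mk_b3]
  simp only [inXi, xi, const2, map_add, map_sub, map_mul, map_one, map_ofNat]

theorem eta_mul_del2_b3 : eta * del2 (inEta (PowerSeries.mk b3))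
    = 4 * ((2 * const2 (b1 0) * eta + 1) * inEta (PowerSeries.mk b2)
      + const2 (b2 0) * (eta * inEta (PowerSeries.mk b1) - 1)) := by
  rw [del2_inEta, ← inEta_X_mul, X_mul_del1_mk_b3]
  simp only [inEta, eta, const2, map_add, map_sub, map_mul, map_one, map_ofNat, PowerSeries.map_X,
    PowerSeries.map_C]

theorem del2_xi_b1 : del2 (inXi (PowerSeries.mk b1)) = inXi (PowerSeries.mk b2) := by
  rw [del2_inXi, del1_mk_b1]

theorem del2_xi_b2 : del2 (inXi (PowerSeries.mk b2)) = inXi (PowerSeries.mk b3) := by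
  rw [del2_inXi, del1_mk_b2]

theorem del2_eta_b1 : del2 (inEta (PowerSeries.mk b1)) = inEta (PowerSeries.mk b2) := by
  rw [del2_inEta, del1_mk_b1]

theorem del2_eta_b2 : del2 (inEta (PowerSeries.mk b2)) = inEta (PowerSeries.mk b3) := by
  rw [del2_inEta, del1_mk_b2]

/-- Only the `𝐪` part of `numSeries` has a nonzero derivative, as the `λ` are constants of `𝒟_1`.
Once the derivatives of `𝐛₃` are eliminated, what remains is divisible by `ξ - η`, so one factor of
`(ξ - η)²` cancels. -/
theorem xi_sub_eta_mul_del2_pSeries : (xi - eta) * del2 pSeries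
    = 2 * (xi * inXi (PowerSeries.mk b2) * (1 - eta * inEta (PowerSeries.mk b1))
      - eta * inEta (PowerSeries.mk b2) * (1 - xi * inXi (PowerSeries.mk b1))) := by
  refine mul_left_cancel₀ xi_sub_eta_ne_zero ?_
  have h := congrArg del2 numSeries_eq
  rw [← pSeries, numSeries, qSeries] at h
  simp only [genSeries, inXi_X_mul, inEta_X_mul, pow_two, map_add, map_sub, Derivation.leibniz,
    smul_eq_mul, del2_xi, del2_eta, del2_const2, del2_lamSeriesOdd, del2_lamSeriesEven,
    Derivation.map_one_eq_zero, derivation_two, derivation_four, D₁_b1, del2_xi_b1, del2_xi_b2, del2_eta_b1,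
    del2_eta_b2] at h
  linear_combination h - xi * eta * (1 - xi * inXi (PowerSeries.mk b1)) * eta_mul_del2_b3
    - xi * eta * (1 - eta * inEta (PowerSeries.mk b1)) * xi_mul_del2_b3

/-- The equation for the fourth derivative of the series of the `p_{s,k}`. -/
theorem del2_four_pSeries : del2 (del2 (del2 (del2 pSeries)))
    = 16 * inXi (PowerSeries.mk b2) * inEta (PowerSeries.mk b2)
      + 8 * const2 (b1 0) * del2 (del2 pSeries)
      + 8 * inXi (PowerSeries.mk b3) * inEta (PowerSeries.mk b1)
      + 4 * const2 (b2 0) * del2 pSeries + 4 * del2 (del2 pShift) := by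
  have eta_ne : eta ≠ 0 := PowerSeries.X_ne_zero
  -- The factor `ξ - η` makes the derivatives of `pSeries` explicit; the factor `η` lets `pShift` be
  -- traded for `pSeries`.
  refine mul_left_cancel₀ (mul_ne_zero eta_ne xi_sub_eta_ne_zero) ?_
  have hs := congrArg (fun N => del2 (del2 N)) pSeries_eq
  have h1 := xi_sub_eta_mul_del2_pSeries
  have hx := xi_mul_del2_b3
  have he := eta_mul_del2_b3
  have x1 := del2_xi_b1
  have x2 := del2_xi_b2
  have e1 := del2_eta_b1
  have e2 := del2_eta_b2
  generalize inXi (PowerSeries.mk b1) = B1 at *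
  generalize inXi (PowerSeries.mk b2) = B2 at *
  generalize inXi (PowerSeries.mk b3) = B3 at *
  generalize inEta (PowerSeries.mk b1) = C1 at *
  generalize inEta (PowerSeries.mk b2) = C2 at *
  generalize inEta (PowerSeries.mk b3) = C3 at *
  have h2 : (xi - eta) * del2 (del2 pSeries)
      = 2 * (xi * B3 * (1 - eta * C1) - eta * C3 * (1 - xi * B1)) := by
    have h := congrArg del2 h1
    simp only [map_sub, Derivation.leibniz, smul_eq_mul, del2_xi, del2_eta,
      Derivation.map_one_eq_zero, derivation_two, x1, x2, e1, e2] at h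
    linear_combination h
  -- The two contributions containing `b2 0` are opposite multiples of `(1 - ξ B1)(1 - η C1)` and
  -- cancel.
  have h3 : (xi - eta) * del2 (del2 (del2 pSeries))
      = 2 * (8 * const2 (b1 0) * (xi * B2 * (1 - eta * C1) - eta * C2 * (1 - xi * B1))
        + 4 * B2 * (1 - eta * C1) - 4 * C2 * (1 - xi * B1)
        + xi * eta * (B2 * C3 - B3 * C2)) := by
    have h := congrArg del2 h2
    simp only [map_sub, Derivation.leibniz, smul_eq_mul, del2_xi, del2_eta,
      Derivation.map_one_eq_zero, derivation_two, x1, e1] at h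
    linear_combination h + 2 * (1 - eta * C1) * hx - 2 * (1 - xi * B1) * he
  have h4 := congrArg del2 h3
  simp only [map_add, map_sub, Derivation.leibniz, smul_eq_mul, del2_xi, del2_eta, del2_const2,
    Derivation.map_one_eq_zero, derivation_two, derivation_four, derivation_eight, x1, x2, e1, e2,
    D₁_b1, mul_zero, add_zero, sub_zero, zero_sub] at h4 hs
  -- In `h4` the derivatives of `B3` and `C3` carry a factor `ξ η`, so `hx` and `he` eliminate them
  -- without division.
  linear_combination eta * h4 + 2 * xi * eta * B2 * he - 2 * eta ^ 2 * C2 * hx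
    - (8 * const2 (b1 0) * eta + 4) * h2 - 4 * const2 (b2 0) * eta * h1 + 4 * (xi - eta) * hs

/-- This is exactly the compatibility of `𝒟_1` and `𝒟_{2m+1}` on the coordinate `b3 n`. -/
theorem D₁_four_p (m n : ℕ) : D₁ (D₁ (D₁ (D₁ (p m n))))
    = 16 * b2 m * b2 n + 8 * b1 0 * D₁ (D₁ (p m n)) + 8 * b3 m * b1 n
      + 4 * b2 0 * D₁ (p m n) + 4 * D₁ (D₁ (p m (n + 1))) := by
  have h := congrArg (coeff2 m n) del2_four_pSeries
  have e4 : (4 : Series2) = const2 4 := (const2_ofNat 4).symm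
  have e8 : (8 : Series2) = const2 8 := (const2_ofNat 8).symm
  have e16 : (16 : Series2) = const2 16 := (const2_ofNat 16).symm
  rw [e4, e8, e16] at h
  simpa only [map_add, mul_assoc, coeff2_const2_mul, coeff2_inXi_mul_inEta, coeff2_del2,
    coeff2_pSeries, coeff2_pShift, PowerSeries.coeff_mk] using h

/-! ### The vector fields commute with `𝒟_1` -/

theorem D_zero : D 0 = D₁ := rfl

theorem two_mul_half_smul (f : Poly) : 2 * ((1 / 2 : ℂ) • f) = f := by
  rw [two_mul, ← add_smul]
  norm_num

theorem two_mul_D_b1 (k n : ℕ) : 2 * D (k + 1) (b1 n) = D₁ (p (k + 1) n) := by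
  simp [D, vectorField, b1, MvPolynomial.mkDerivation_X, -one_div,
    -Algebra.mul_smul_comm, two_mul_half_smul]

theorem two_mul_D_b2 (k n : ℕ) : 2 * D (k + 1) (b2 n) = D₁ (D₁ (p (k + 1) n)) := by
  simp [D, vectorField, b2, MvPolynomial.mkDerivation_X, -one_div,
    -Algebra.mul_smul_comm, two_mul_half_smul]

theorem two_mul_D_b3 (k n : ℕ) : 2 * D (k + 1) (b3 n) = D₁ (D₁ (D₁ (p (k + 1) n))) := by
  simp [D, vectorField, b3, MvPolynomial.mkDerivation_X, -one_div,
    -Algebra.mul_smul_comm, two_mul_half_smul]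

theorem D₁_two_mul (f : Poly) : D₁ (2 * f) = 2 * D₁ f := by
  rw [Derivation.leibniz, derivation_two, smul_zero, add_zero, smul_eq_mul]

/-- This comes from `p_{s,1} = 2 b_{1,s}`, and covers the potential `u = b_{1,1}`, whose derivatives
enter every commutator with `ℒ`. -/
theorem D_b1_zero (k : ℕ) : D k (b1 0) = b2 k := by
  cases k with
  | zero => exact D₁_b1 0
  | succ k =>
    refine mul_left_cancel₀ (two_ne_zero (α := Poly)) ?_
    rw [two_mul_D_b1, p_zero_right, D₁_two_mul, D₁_b1]

theorem D_b2_zero (k : ℕ) : D k (b2 0) = b3 k := by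
  cases k with
  | zero => exact D₁_b2 0
  | succ k =>
    refine mul_left_cancel₀ (two_ne_zero (α := Poly)) ?_
    rw [two_mul_D_b2, p_zero_right, D₁_two_mul, D₁_two_mul, D₁_b1, D₁_b2]

/-- A derivation is determined by its values on the coordinates. The `b1` and `b2` cases hold
because the components of `𝒟_s` are successive `𝒟_1`-derivatives; only `b3` needs the equation for
`p`. -/
theorem lie_D₁_D (k : ℕ) : ⁅D₁, D k⁆ = 0 := by
  cases k with
  | zero => exact lie_self _
  | succ k =>
    refine MvPolynomial.derivation_ext fun x => ?_
    obtain ⟨i, n⟩ := x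
    rw [Derivation.commutator_apply, Derivation.zero_apply, sub_eq_zero]
    refine mul_left_cancel₀ (two_ne_zero (α := Poly)) ?_
    rw [← D₁_two_mul]
    fin_cases i
    · change D₁ (2 * D (k + 1) (b1 n)) = 2 * D (k + 1) (D₁ (b1 n))
      rw [two_mul_D_b1, D₁_b1, two_mul_D_b2]
    · change D₁ (2 * D (k + 1) (b2 n)) = 2 * D (k + 1) (D₁ (b2 n))
      rw [two_mul_D_b2, D₁_b2, two_mul_D_b3]
    · change D₁ (2 * D (k + 1) (b3 n)) = 2 * D (k + 1) (D₁ (b3 n))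
      rw [two_mul_D_b3, D₁_b3, D₁_four_p]
      simp only [map_add, Derivation.leibniz, smul_eq_mul, derivation_two, derivation_four, D_b1_zero, D_b2_zero]
      have h1 := two_mul_D_b1 k n
      have h2 := two_mul_D_b2 k n
      have h3 := two_mul_D_b2 k (n + 1)
      linear_combination (-8 * b1 0) * h2 - 4 * b2 0 * h1 - 4 * h3

/-! ### The operators -/

theorem D₁_D_comm (k : ℕ) (f : Poly) : D₁ (D k f) = D k (D₁ f) := by
  have h := congrArg (fun d : Derivation ℂ Poly Poly => d f) (lie_D₁_D k)
  simpa [Derivation.commutator_apply, sub_eq_zero] using h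

theorem opD_apply (k : ℕ) (f : Poly) : opD k f = D k f := rfl

theorem mulOp_apply (g f : Poly) : mulOp g f = g * f := rfl

theorem opL_apply (f : Poly) : opL f = D₁ (D₁ f) - 2 * b1 0 * f := by
  simp [opL, pow_two, opD_apply, mulOp_apply, D_zero]

/-- Since `𝒟_{2k+1}` commutes with `𝒟_1²`, only the potential of `ℒ` contributes. -/
theorem lie_opL_opD (k : ℕ) : ⁅opL, opD k⁆ = mulOp (D k (2 * b1 0)) := by
  refine LinearMap.ext fun f => ?_
  rw [Ring.lie_def, LinearMap.sub_apply, Module.End.mul_apply, Module.End.mul_apply]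
  simp only [opL_apply, opD_apply, mulOp_apply, map_sub, D₁_D_comm, Derivation.leibniz,
    smul_eq_mul, derivation_two]
  ring

/-- The operator `ℬ_{2k+3}` in terms of `ℒ`. -/
theorem two_mul_opB_apply (k : ℕ) (f : Poly) : 2 * opB (k + 1) f
    = 2 * D k (opL f) + b2 k * f - 2 * b1 k * D₁ f - 2 * D (k + 1) f := by
  have h : 2 * opB (k + 1) f = 2 * (D k (D₁ (D₁ f)) - (b1 0 * D k f + D k (b1 0 * f)))
      - (b1 k * D₁ f + D₁ (b1 k * f)) - 2 * D (k + 1) f := by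
    simp only [opB, Nat.add_sub_cancel, pow_two, LinearMap.sub_apply, LinearMap.add_apply,
      LinearMap.smul_apply, Module.End.mul_apply, opD_apply, mulOp_apply, D_zero, mul_sub,
      two_mul_half_smul]
  rw [h, opL_apply]
  simp only [map_sub, Derivation.leibniz, smul_eq_mul, derivation_two, D_b1_zero, D₁_b1]
  ring

/-- The second-order parts of `[ℒ, 𝒟_{2k+1} ℒ]` and `[ℒ, b_{1,2k+1} 𝒟_1]` cancel, and `½ b_{2,2k+1}`
removes the first-order part. The order-zero remainder is `½ D₁ (b3 k)` minus half of its prescribed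
value. -/
theorem lie_opL_opB (k : ℕ) : ⁅opL, opB (k + 1)⁆ = 0 := by
  refine LinearMap.ext fun f => ?_
  rw [Ring.lie_def, LinearMap.sub_apply, Module.End.mul_apply, Module.End.mul_apply,
    LinearMap.zero_apply]
  refine mul_left_cancel₀ (two_ne_zero (α := Poly)) ?_
  have hL : ∀ g : Poly, 2 * opL g = opL (2 * g) := fun g => by
    rw [opL_apply, opL_apply, D₁_two_mul, D₁_two_mul]
    ring
  have hD : ∀ (n : ℕ) (g : Poly), opL (D n g) = D n (opL g) + 2 * b2 n * g := fun n g => by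
    have h := congrArg (fun T : Op => T g) (lie_opL_opD n)
    simp only [Ring.lie_def, LinearMap.sub_apply, Module.End.mul_apply, opD_apply, mulOp_apply,
      Derivation.leibniz, derivation_two, D_b1_zero, smul_eq_mul] at h
    linear_combination h
  rw [mul_sub, hL, two_mul_opB_apply, two_mul_opB_apply]
  -- `ℒ` is moved past the vector fields before it is unfolded, so that the terms in `D k (opL (opL
  -- f))` and `D (k + 1) (opL f)` match on both sides.
  simp only [map_sub, map_add, mul_assoc, ← hL, hD]
  simp only [opL_apply, map_sub, map_add, Derivation.leibniz, smul_eq_mul, derivation_two,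
    D₁_b1, D₁_b2, D₁_b3]
  ring

theorem commute_opL_opB_mul_pow (k n : ℕ) : Commute opL (opB (k + 1) * opL ^ n) := by
  have h := lie_opL_opB k
  rw [Ring.lie_def, sub_eq_zero] at h
  exact Commute.mul_right h ((Commute.refl opL).pow_right n)

end PolyKdV

end

theorem mainTheorem7 (k : ℕ) :
    PolyKdV.mulOp (PolyKdV.D k (2 * PolyKdV.b1 0)) =
      ⁅PolyKdV.opL, PolyKdV.opA k
        + ∑ j ∈ Finset.range (k - 1), PolyKdV.mulOp (PolyKdV.par (k - j)) * PolyKdV.opA j⁆ := by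
  have h : Commute PolyKdV.opL
      (∑ j ∈ Finset.Icc 1 k, PolyKdV.opB j * PolyKdV.opL ^ (k - j)) := by
    refine Commute.sum_right _ _ _ fun j hj => ?_
    rw [Finset.mem_Icc] at hj
    -- The bound `1 ≤ j` matters: `opB 0` involves a truncated index and is not one of the operators
    -- `ℬ`.
    obtain ⟨i, rfl⟩ : ∃ i, j = i + 1 := ⟨j - 1, by omega⟩
    exact PolyKdV.commute_opL_opB_mul_pow i _
  -- The sum with the parameters cancels against the one subtracted in the recursion for `opA k`; by
  -- `h` the `ℬ` terms then drop out of the commutator.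
  rw [PolyKdV.opA_eq, sub_add_cancel, ← PolyKdV.lie_opL_opD, Ring.lie_def, Ring.lie_def, mul_add,
    add_mul, h.eq, add_sub_add_left_eq_sub]
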